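/- Let $\Omega\subset\mathbb R^3$ be a bounded domain of class $C^1$, $T>0$, $Q=(0,T)\times\Omega$, $H=L^2(\Omega)$, $V=H^1(\Omega)$ and $W=\{u\in H^2(\Omega):\partial_N u=0 \text{ on }\partial\Omega\}$ (with the $H^2$-norm). Let $\ell,\alpha,k,\nu,\gamma>0$. Let $\widehat\beta:\mathbb R\to[0,+\infty]$ be proper, lower semicontinuous and convex with $\widehat\beta(0)=0$, and $\beta=\partial\widehat\beta$; let $\widehat\pi\in C^1(\mathbb R)$ have a Lipschitz continuous derivative $\pi=\widehat\pi'$; let $A:H\to 2^H$ be maximal monotone with $0\in A(0)$ and $\|v\|_H\le C_A(1+\|x\|_H)$ for all $x\in H$, $v\in Ax$, for some constant $C_A>0$. For data $f\in L^2(Q)$, $\eta^*\in W$, $\eta_0,\varphi_0\in V$, a solution of problem $(P)$ is a pair $(\eta,\varphi)$ with $$\eta,\varphi\in H^1(0,T;H)\cap L^\infty(0,T;V)\cap L^2(0,T;W)$$ for which there are $\zeta\in L^2(0,T;H)$ and $\xi\in L^2(Q)$ such that $$\partial_t(\eta+(\ell-\alpha)\varphi)-k\Delta\eta+k\alpha\Delta\varphi+\zeta=f-k\Delta\eta^*\quad\text{a.e.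 in }Q,$$ $$\partial_t\varphi-\nu\Delta\varphi+\xi+\pi(\varphi)=\gamma(\eta-\alpha\varphi+\eta^*)\quad\text{a.e. in }Q,$$ $$\zeta(t)\in A(\eta(t))\ \text{for a.e. }t\in(0,T),\qquad \xi\in\beta(\varphi)\ \text{a.e. in }Q,\qquad \eta(0)=\eta_0,\ \varphi(0)=\varphi_0\ \text{in }\Omega.$$ Assume $\alpha=\ell$. Then: (i) For all data as above, problem $(P)$ has at most one solution $(\eta,\varphi)$. (ii) There is a constant $C>0$, depending only on $\Omega$, $T$, the parameters $\ell,\alpha,k,\nu,\gamma$ and a Lipschitz constant of $\pi$, such that whenever $(\eta_i,\varphi_i)$ is a solution of $(P)$ for the data $f_i,\eta^*_i,\eta_{0_i},\varphi_{0_i}$ ($i=1,2$), $$\|\eta_1-\eta_2\|_{L^\infty(0,T;H)\cap L^2(0,T;V)}+\|\varphi_1-\varphi_2\|_{L^\infty(0,T;H)\cap L^2(0,T;V)}\le C\big(\|f_1-f_2\|_{L^2(Q)}+\|\eta^*_1-\eta^*_2\|_W+\|\eta_{0_1}-\eta_{0_2}\|_H+\|\varphi_{0_1}-\varphi_{0_2}\|_H\big),$$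 where $\|u\|_{L^\infty(0,T;H)\cap L^2(0,T;V)}=\|u\|_{L^\infty(0,T;H)}+\|u\|_{L^2(0,T;V)}$. -/

import Mathlib

open MeasureTheory Set
open scoped ENNReal NNReal ContDiff RealInnerProductSpace

noncomputable section

namespace PhaseField

/-- The ambient space `ℝ³` with its Euclidean norm. -/
abbrev E3 := EuclideanSpace ℝ (Fin 3)

/-- A bounded domain of class `C¹` in `ℝ³`: a bounded connected nonempty open set which near each
boundary point is the sublevel set of a `C¹` function without critical points. -/
structure IsBoundedC1Domain (Ω : Set E3) : Prop where
  isOpen : IsOpen Ω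
  isConnected : IsConnected Ω
  isBounded : Bornology.IsBounded Ω
  boundary : ∀ x ∈ frontier Ω, ∃ (U : Set E3) (ψ : E3 → ℝ), IsOpen U ∧ x ∈ U ∧
    ContDiffOn ℝ 1 ψ U ∧ (∀ y ∈ U, fderiv ℝ ψ y ≠ 0) ∧ Ω ∩ U = {y ∈ U | ψ y < 0}

/-! ### Function spaces on `Ω` -/

/-- `H = L²(Ω)`. -/
abbrev L2 (Ω : Set E3) := Lp ℝ 2 (volume.restrict Ω)

/-- `v` is the weak partial derivative of `u` in the `i`-th coordinate direction, tested against
`C_c^∞(Ω)`. -/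
def IsWeakPartial (Ω : Set E3) (i : Fin 3) (u v : L2 Ω) : Prop :=
  ∀ φ : E3 → ℝ, ContDiff ℝ ∞ φ → HasCompactSupport φ → tsupport φ ⊆ Ω →
    ∫ x in Ω, u x * fderiv ℝ φ x (EuclideanSpace.single i 1) = - ∫ x in Ω, v x * φ x

theorem integrable_mul_test {Ω : Set E3} (u : L2 Ω) {g : E3 → ℝ} (hg : Continuous g)
    (hc : HasCompactSupport g) : Integrable (fun x => u x * g x) (volume.restrict Ω) :=
  (Lp.memLp u).integrable_mul (q := 2) ((hg.memLp_of_hasCompactSupport hc).restrict Ω)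

theorem continuous_test {φ : E3 → ℝ} (hφ : ContDiff ℝ ∞ φ) (w : E3) :
    Continuous (fun x => fderiv ℝ φ x w) :=
  (hφ.continuous_fderiv (by simp)).clm_apply continuous_const

theorem compact_test {φ : E3 → ℝ} (hc : HasCompactSupport φ) (w : E3) :
    HasCompactSupport (fun x => fderiv ℝ φ x w) :=
  hc.fderiv_apply ℝ w

theorem isWeakPartial_zero (Ω : Set E3) (i : Fin 3) : IsWeakPartial Ω i 0 0 := by
  intro φ _ _ _
  have h0 : ∀ g : E3 → ℝ, ∫ x in Ω, (0 : L2 Ω) x * g x = 0 := by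
    intro g
    refine integral_eq_zero_of_ae ?_
    filter_upwards [Lp.coeFn_zero ℝ 2 (volume.restrict Ω)] with x hx
    rw [hx]; simp
  rw [h0, h0, neg_zero]

theorem IsWeakPartial.add {Ω : Set E3} {i : Fin 3} {u v u' v' : L2 Ω}
    (h : IsWeakPartial Ω i u v) (h' : IsWeakPartial Ω i u' v') :
    IsWeakPartial Ω i (u + u') (v + v') := by
  intro φ h1 h2 h3
  have key : ∀ (a b : L2 Ω) (g : E3 → ℝ), Continuous g → HasCompactSupport g →
      ∫ x in Ω, (a + b : L2 Ω) x * g x = (∫ x in Ω, a x * g x) + ∫ x in Ω, b x * g x := by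
    intro a b g hg hc
    rw [← integral_add (integrable_mul_test a hg hc) (integrable_mul_test b hg hc)]
    refine integral_congr_ae ?_
    filter_upwards [Lp.coeFn_add a b] with x hx
    rw [hx, Pi.add_apply, add_mul]
  rw [key _ _ _ (continuous_test h1 _) (compact_test h2 _), key _ _ _ h1.continuous h2,
    h φ h1 h2 h3, h' φ h1 h2 h3]
  ring

theorem IsWeakPartial.smul {Ω : Set E3} {i : Fin 3} {u v : L2 Ω} (c : ℝ)
    (h : IsWeakPartial Ω i u v) : IsWeakPartial Ω i (c • u) (c • v) := by
  intro φ h1 h2 h3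
  have key : ∀ (a : L2 Ω) (g : E3 → ℝ),
      ∫ x in Ω, (c • a : L2 Ω) x * g x = c * ∫ x in Ω, a x * g x := by
    intro a g
    rw [← integral_const_mul]
    refine integral_congr_ae ?_
    filter_upwards [Lp.coeFn_smul c a] with x hx
    rw [hx, Pi.smul_apply, smul_eq_mul, mul_assoc]
  rw [key, key, h φ h1 h2 h3]
  ring

/-- `V = H¹(Ω)` as a subspace: pairs `(u, ∇u)` of an `L²` function and its weak gradient in `L²`,
with the norm `‖u‖_V² = ‖u‖² + ∑ᵢ ‖∂ᵢu‖²`. (The gradient is determined by `u`, so this is the usual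
space.) -/
def h1Submodule (Ω : Set E3) :
    Submodule ℝ (WithLp 2 (L2 Ω × PiLp 2 (fun _ : Fin 3 => L2 Ω))) where
  carrier := {p | ∀ i, IsWeakPartial Ω i p.fst (p.snd i)}
  add_mem' := fun ha hb i => (ha i).add (hb i)
  zero_mem' := fun i => isWeakPartial_zero Ω i
  smul_mem' := fun c _ ha i => (ha i).smul c

/-- `V = H¹(Ω)` with its usual norm and inner product. -/
def H1 (Ω : Set E3) : Type := h1Submodule Ω

instance (Ω : Set E3) : NormedAddCommGroup (H1 Ω) :=
  inferInstanceAs (NormedAddCommGroup (h1Submodule Ω))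

instance (Ω : Set E3) : InnerProductSpace ℝ (H1 Ω) :=
  inferInstanceAs (InnerProductSpace ℝ (h1Submodule Ω))

/-- The inclusion `H¹(Ω) → L²(Ω)`. -/
def H1.toL2 {Ω : Set E3} : H1 Ω →ₗ[ℝ] L2 Ω where
  toFun u := u.1.fst
  map_add' _ _ := rfl
  map_smul' _ _ := rfl

/-- The weak partial derivative `∂ᵢu` of `u ∈ H¹(Ω)`. -/
def H1.partialD {Ω : Set E3} (i : Fin 3) : H1 Ω →ₗ[ℝ] L2 Ω where
  toFun u := u.1.snd i
  map_add' _ _ := rfl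
  map_smul' _ _ := rfl

/-- `H²(Ω)` as a subspace: pairs `(u, D²u)` of an `H¹` function and the matrix of its second weak
derivatives in `L²`, with the norm `‖u‖_{H²}² = ‖u‖_{H¹}² + ∑ᵢⱼ ‖∂ⱼ∂ᵢu‖²`. -/
def h2Submodule (Ω : Set E3) :
    Submodule ℝ (WithLp 2 (H1 Ω × PiLp 2 (fun _ : Fin 3 × Fin 3 => L2 Ω))) where
  carrier := {p | ∀ i j, IsWeakPartial Ω j (H1.partialD i p.fst) (p.snd (i, j))}
  add_mem' := fun ha hb i j => (ha i j).add (hb i j)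
  zero_mem' := fun _ j => isWeakPartial_zero Ω j
  smul_mem' := fun c _ ha i j => (ha i j).smul c

/-- `H²(Ω)` with its usual norm and inner product. -/
def H2 (Ω : Set E3) : Type := h2Submodule Ω

instance (Ω : Set E3) : NormedAddCommGroup (H2 Ω) :=
  inferInstanceAs (NormedAddCommGroup (h2Submodule Ω))

instance (Ω : Set E3) : InnerProductSpace ℝ (H2 Ω) :=
  inferInstanceAs (InnerProductSpace ℝ (h2Submodule Ω))

/-- The inclusion `H²(Ω) → H¹(Ω)`. -/
def H2.toH1 {Ω : Set E3} : H2 Ω →ₗ[ℝ] H1 Ω where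
  toFun u := u.1.fst
  map_add' _ _ := rfl
  map_smul' _ _ := rfl

/-- The second weak derivative `∂ⱼ∂ᵢu` of `u ∈ H²(Ω)`. -/
def H2.partialD2 {Ω : Set E3} (i j : Fin 3) : H2 Ω →ₗ[ℝ] L2 Ω where
  toFun u := u.1.snd (i, j)
  map_add' _ _ := rfl
  map_smul' _ _ := rfl

/-- The Laplacian `Δu ∈ L²(Ω)` of `u ∈ H²(Ω)`. -/
def H2.laplacian {Ω : Set E3} : H2 Ω →ₗ[ℝ] L2 Ω := ∑ i : Fin 3, H2.partialD2 i i

/-- The normal derivative of `u ∈ H²(Ω)`, as a functional on `H¹(Ω)` through Green's formula: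
`⟨∂_N u, v⟩ = ∫_Ω ∇u · ∇v + ∫_Ω Δu v`. On a `C¹` domain this is `∫_Γ (∂_N u) v`. -/
def H2.normalDeriv {Ω : Set E3} (u : H2 Ω) (v : H1 Ω) : ℝ :=
  (∑ i : Fin 3, ⟪H1.partialD i (H2.toH1 u), H1.partialD i v⟫) + ⟪H2.laplacian u, H1.toL2 v⟫

/-- `W = {u ∈ H²(Ω) : ∂_N u = 0 on ∂Ω}` as a subspace of `H²(Ω)`. -/
def wSubmodule (Ω : Set E3) : Submodule ℝ (H2 Ω) where
  carrier := {u | ∀ v : H1 Ω, H2.normalDeriv u v = 0}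
  add_mem' := by
    intro a b ha hb v
    have h : H2.normalDeriv (a + b) v = H2.normalDeriv a v + H2.normalDeriv b v := by
      simp only [H2.normalDeriv, map_add, inner_add_left, Finset.sum_add_distrib]
      ring
    rw [h, ha v, hb v, add_zero]
  zero_mem' := by
    intro v
    simp only [H2.normalDeriv, map_zero, inner_zero_left, Finset.sum_const_zero, add_zero]
  smul_mem' := by
    intro c a ha v
    have h : H2.normalDeriv (c • a) v = c * H2.normalDeriv a v := by
      simp only [H2.normalDeriv, map_smul, real_inner_smul_left, ← Finset.mul_sum]
      ring
    rw [h, ha v, mul_zero]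

/-- `W`, with the norm of `H²(Ω)`. -/
def W (Ω : Set E3) : Type := wSubmodule Ω

instance (Ω : Set E3) : NormedAddCommGroup (W Ω) :=
  inferInstanceAs (NormedAddCommGroup (wSubmodule Ω))

instance (Ω : Set E3) : InnerProductSpace ℝ (W Ω) :=
  inferInstanceAs (InnerProductSpace ℝ (wSubmodule Ω))

/-- The inclusion `W → H²(Ω)`. -/
def W.toH2 {Ω : Set E3} : W Ω →ₗ[ℝ] H2 Ω where
  toFun u := u.1
  map_add' _ _ := rfl
  map_smul' _ _ := rfl

/-- The inclusion `W → L²(Ω)`. -/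
def W.toL2 {Ω : Set E3} : W Ω →ₗ[ℝ] L2 Ω := H1.toL2 ∘ₗ H2.toH1 ∘ₗ W.toH2

/-- The Laplacian on `W`. -/
def W.laplacian {Ω : Set E3} : W Ω →ₗ[ℝ] L2 Ω := H2.laplacian ∘ₗ W.toH2

/-! ### Spaces of time-dependent functions -/

/-- Lebesgue measure on the time interval `(0, T)`. -/
abbrev timeMeasure (T : ℝ) : Measure ℝ := volume.restrict (Ioo 0 T)

/-- `L²(Q)`, where `Q = (0, T) × Ω`. -/
abbrev L2Q (Ω : Set E3) (T : ℝ) := Lp ℝ 2 ((timeMeasure T).prod (volume.restrict Ω))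

/-- `uX` is a version of `u : (0, T) → L²(Ω)` with values in `X`, where `X` is regarded as a
subspace of `L²(Ω)` through `ι`. -/
def IsLift {Ω : Set E3} {X : Type*} (T : ℝ) (ι : X → L2 Ω) (u : ℝ → L2 Ω) (uX : ℝ → X) : Prop :=
  ∀ᵐ t ∂timeMeasure T, ι (uX t) = u t

/-- `u ∈ L^p(0, T; X)` (Bochner space), for `X ⊆ L²(Ω)` through `ι`. -/
def MemBochner {Ω : Set E3} {X : Type*} [NormedAddCommGroup X] (T : ℝ) (p : ℝ≥0∞) (ι : X → L2 Ω)
    (u : ℝ → L2 Ω) : Prop :=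
  ∃ uX : ℝ → X, MemLp uX p (timeMeasure T) ∧ IsLift T ι u uX

/-- The norm of `u` in `L^p(0, T; X)`, for `X ⊆ L²(Ω)` through the injection `ι`. It is `∞` if `u`
does not take its values in `X` almost everywhere; otherwise the version `uX` with values in `X`
is unique up to null sets. -/
def bochnerNorm {Ω : Set E3} {X : Type*} [NormedAddCommGroup X] (T : ℝ) (p : ℝ≥0∞) (ι : X → L2 Ω)
    (u : ℝ → L2 Ω) : ℝ≥0∞ :=
  ⨅ (uX : ℝ → X) (_ : IsLift T ι u uX), eLpNorm uX p (timeMeasure T)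

/-- `u ∈ H¹(0, T; L²(Ω))` with `∂ₜu = u'`, where `u` stands for the representative that is
absolutely continuous on `[0, T]`. -/
structure HasTimeDeriv {Ω : Set E3} (T : ℝ) (u u' : ℝ → L2 Ω) : Prop where
  memLp : MemLp u' 2 (timeMeasure T)
  eq_integral : ∀ t ∈ Icc 0 T, u t = u 0 + ∫ s in (0 : ℝ)..t, u' s

/-- The norm of `u` in `L^∞(0, T; H) ∩ L²(0, T; V)`. -/
def energyNorm {Ω : Set E3} (T : ℝ) (u : ℝ → L2 Ω) : ℝ≥0∞ :=
  eLpNorm u ∞ (timeMeasure T) + bochnerNorm T 2 (H1.toL2 (Ω := Ω)) u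

/-! ### The nonlinearities -/

/-- `β̂ : ℝ → [0, +∞]` is proper, lower semicontinuous and convex with `β̂(0) = 0` (properness is
contained in the last condition). -/
structure IsConvexPotential (βhat : ℝ → ℝ≥0∞) : Prop where
  lsc : LowerSemicontinuous βhat
  convex : ConvexOn ℝ≥0 univ βhat
  zero : βhat 0 = 0

/-- The subdifferential `∂β̂(r)`. -/
def subdifferential (βhat : ℝ → ℝ≥0∞) (r : ℝ) : Set ℝ :=
  {ξ | ∀ s : ℝ, (βhat r : EReal) + ((ξ * (s - r) : ℝ) : EReal) ≤ (βhat s : EReal)}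

/-- A multivalued operator `A : H → 2^H` on a real Hilbert space is maximal monotone. -/
structure IsMaximalMonotone {H : Type*} [NormedAddCommGroup H] [InnerProductSpace ℝ H]
    (A : H → Set H) : Prop where
  monotone : ∀ x y, ∀ u ∈ A x, ∀ v ∈ A y, 0 ≤ ⟪u - v, x - y⟫
  maximal : ∀ x u, (∀ y, ∀ v ∈ A y, 0 ≤ ⟪u - v, x - y⟫) → u ∈ A x

/-- The assumptions on `A`: it is maximal monotone with `0 ∈ A(0)` and at most linear growth. -/
structure IsAdmissibleOperator {Ω : Set E3} (A : L2 Ω → Set (L2 Ω)) : Prop where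
  maximalMonotone : IsMaximalMonotone A
  zero_mem : 0 ∈ A 0
  growth : ∃ C > 0, ∀ x, ∀ v ∈ A x, ‖v‖ ≤ C * (1 + ‖x‖)

/-! ### The problem -/

/-- The constants of the system. -/
structure Parameters where
  ell : ℝ
  alpha : ℝ
  k : ℝ
  nu : ℝ
  gamma : ℝ

/-- All constants of the system are positive. -/
structure Parameters.Positive (P : Parameters) : Prop where
  ell : 0 < P.ell
  alpha : 0 < P.alpha
  k : 0 < P.k
  nu : 0 < P.nu
  gamma : 0 < P.gamma

/-- The data: `f ∈ L²(Q)`, `η* ∈ W` and `η₀, φ₀ ∈ V`. -/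
structure Data (Ω : Set E3) (T : ℝ) where
  f : L2Q Ω T
  etaStar : W Ω
  eta0 : H1 Ω
  phi0 : H1 Ω

/-- `(η, φ)` solves problem `(P)`, with time derivatives `ηt, φt`, with `ηW, φW` the versions of
`η, φ` with values in `W`, and with selections `ζ`, `ξ`. Properties that hold almost everywhere
in `Q` are written slice by slice, for a.e. `t` and then a.e. `x`. -/
structure SolvesWith {Ω : Set E3} {T : ℝ} (P : Parameters) (βhat : ℝ → ℝ≥0∞) (πhat : ℝ → ℝ)
    (A : L2 Ω → Set (L2 Ω)) (d : Data Ω T) (η φ ηt φt : ℝ → L2 Ω) (ηW φW : ℝ → W Ω)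
    (ζ : ℝ → L2 Ω) (ξ : L2Q Ω T) : Prop where
  eta_H1H : HasTimeDeriv T η ηt
  phi_H1H : HasTimeDeriv T φ φt
  eta_LinftyV : MemBochner T ∞ (H1.toL2 (Ω := Ω)) η
  phi_LinftyV : MemBochner T ∞ (H1.toL2 (Ω := Ω)) φ
  eta_L2W : MemLp ηW 2 (timeMeasure T) ∧ IsLift T W.toL2 η ηW
  phi_L2W : MemLp φW 2 (timeMeasure T) ∧ IsLift T W.toL2 φ φW
  zeta_L2H : MemLp ζ 2 (timeMeasure T)
  /-- `∂ₜ(η + (ℓ - α) φ) - k Δη + k α Δφ + ζ = f - k Δη*` -/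
  eq_eta : ∀ᵐ t ∂timeMeasure T, ∀ᵐ x ∂volume.restrict Ω,
    ηt t x + (P.ell - P.alpha) * φt t x - P.k * W.laplacian (ηW t) x
      + P.k * P.alpha * W.laplacian (φW t) x + ζ t x
      = d.f (t, x) - P.k * W.laplacian d.etaStar x
  /-- `∂ₜφ - ν Δφ + ξ + π(φ) = γ (η - α φ + η*)` -/
  eq_phi : ∀ᵐ t ∂timeMeasure T, ∀ᵐ x ∂volume.restrict Ω,
    φt t x - P.nu * W.laplacian (φW t) x + ξ (t, x) + deriv πhat (φ t x)
      = P.gamma * (η t x - P.alpha * φ t x + W.toL2 d.etaStar x)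
  zeta_mem : ∀ᵐ t ∂timeMeasure T, ζ t ∈ A (η t)
  xi_mem : ∀ᵐ t ∂timeMeasure T, ∀ᵐ x ∂volume.restrict Ω,
    ξ (t, x) ∈ subdifferential βhat (φ t x)
  eta_init : η 0 = H1.toL2 d.eta0
  phi_init : φ 0 = H1.toL2 d.phi0

/-- `(η, φ)` is a solution of problem `(P)` with the regularity
`H¹(0, T; H) ∩ L^∞(0, T; V) ∩ L²(0, T; W)`. The boundary conditions are part of `W`. -/
def IsSolution {Ω : Set E3} {T : ℝ} (P : Parameters) (βhat : ℝ → ℝ≥0∞) (πhat : ℝ → ℝ)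
    (A : L2 Ω → Set (L2 Ω)) (d : Data Ω T) (η φ : ℝ → L2 Ω) : Prop :=
  ∃ (ηt φt : ℝ → L2 Ω) (ηW φW : ℝ → W Ω) (ζ : ℝ → L2 Ω) (ξ : L2Q Ω T),
    SolvesWith P βhat πhat A d η φ ηt φt ηW φW ζ ξ

end PhaseField

end

open PhaseField

/-! The proof is an energy estimate for the differences w = η₁ - η₂ and p = φ₁ - φ₂. For α = ℓ the
term ∂ₜφ drops out of the first equation, so the coupling left there is kαΔp. Test that equation
with w: Green's formula on `W` turns the coupling into kα∫∇p·∇w, and Young's inequality bounds twice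
this by k‖∇w‖² + kα²‖∇p‖². The first piece is absorbed by the dissipation 2k‖∇w‖². For the second,
test the other equation with Mp, where Mν = kα²; its dissipation 2kα²‖∇p‖² absorbs the rest.

The selections of A and β contribute nonnegative terms by monotonicity, π is controlled by its
Lipschitz constant, and -kΔη* is kept as a source in L² bounded by the norm of `W`. This
pointwise-in-time bound is `energy_inequality`. The energy identity `norm_sq_eq_of_eq_primitive` and
Grönwall's inequality in the form `energy_dissipation_le` integrate it in `energy_estimate`. Both
claims then follow from `exists_bound_of_isSolution`; uniqueness is the case of equal data. -/

/-! ### Energy identity and Grönwall's inequality -/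

section Primitive

variable {H : Type*} [NormedAddCommGroup H]

theorem continuousOn_of_eq_primitive [NormedSpace ℝ H] {u u' : ℝ → H} {T : ℝ} (hT : 0 ≤ T)
    (hu' : IntervalIntegrable u' volume 0 T)
    (h : ∀ t ∈ Icc 0 T, u t = u 0 + ∫ s in (0 : ℝ)..t, u' s) : ContinuousOn u (Icc 0 T) := by
  have h1 := intervalIntegral.continuousOn_primitive_interval
    ((intervalIntegrable_iff' (by simp)).1 hu')
  rw [uIcc_of_le hT] at h1
  exact (continuousOn_const.add h1).congr h

/-- By the triangle inequality, the increments of the norm are dominated by those of the scalar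
primitive of ‖g‖, which is absolutely continuous. Passing to the norm brings the fundamental theorem
for real-valued absolutely continuous functions to bear on a Hilbert-valued u. -/
theorem absolutelyContinuousOnInterval_norm_primitive [NormedSpace ℝ H] [CompleteSpace H]
    {g : ℝ → H} {T : ℝ} (hg : IntervalIntegrable g volume 0 T) (c : H) :
    AbsolutelyContinuousOnInterval (fun t => ‖c + ∫ s in (0 : ℝ)..t, g s‖) 0 T := by
  have hv := hg.norm.absolutelyContinuousOnInterval_intervalIntegral (c := 0) (by simp)
  refine squeeze_zero' (.of_forall fun E => Finset.sum_nonneg fun _ _ => dist_nonneg) ?_ hv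
  filter_upwards [Filter.mem_inf_of_right (Filter.mem_principal_self _)] with E hE
  refine Finset.sum_le_sum fun i hi => ?_
  obtain ⟨ha, hb⟩ := hE.1 i hi
  have hI : ∀ {x}, x ∈ uIcc 0 T → IntervalIntegrable g volume 0 x := fun hx =>
    hg.mono_set (uIcc_subset_uIcc (by simp) hx)
  refine (abs_norm_sub_norm_le _ _).trans ?_
  rw [add_sub_add_left_eq_sub, intervalIntegral.integral_interval_sub_left (hI ha) (hI hb),
    Real.dist_eq, intervalIntegral.integral_interval_sub_left (hI ha).norm (hI hb).norm]
  exact intervalIntegral.norm_integral_le_abs_integral_norm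

/-- The energy identity for a function with an integrable time derivative. -/
theorem norm_sq_eq_of_eq_primitive [InnerProductSpace ℝ H] [CompleteSpace H] {u u' : ℝ → H}
    {T : ℝ} (hT : 0 ≤ T) (hu' : IntervalIntegrable u' volume 0 T)
    (h : ∀ t ∈ Icc 0 T, u t = u 0 + ∫ s in (0 : ℝ)..t, u' s) :
    ‖u T‖ ^ 2 = ‖u 0‖ ^ 2 + ∫ s in (0 : ℝ)..T, 2 * ⟪u' s, u s⟫ := by
  have hAC := absolutelyContinuousOnInterval_norm_primitive hu' (u 0)
  -- The square of the norm is a product of absolutely continuous functions, hence the integral of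
  -- its derivative; that derivative is identified a.e. by Lebesgue differentiation of the Bochner
  -- integral.
  have hF := (hAC.fun_mul hAC).integral_deriv_eq_sub
  have hd : ∫ s in (0 : ℝ)..T, deriv (fun t => ‖u 0 + ∫ s in (0 : ℝ)..t, u' s‖ *
      ‖u 0 + ∫ s in (0 : ℝ)..t, u' s‖) s = ∫ s in (0 : ℝ)..T, 2 * ⟪u' s, u s⟫ := by
    refine intervalIntegral.integral_congr_ae ?_
    filter_upwards [hu'.ae_hasDerivAt_integral] with s hs hsT
    have hsI := uIoc_subset_uIcc hsT
    have h1 := ((hs hsI 0 (by simp)).const_add (u 0)).norm_sq.deriv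
    simp only [pow_two] at h1
    rw [h1, ← h s (by rwa [uIcc_of_le hT] at hsI), real_inner_comm]
  rw [hd, ← h T ⟨hT, le_rfl⟩] at hF
  simp only [intervalIntegral.integral_same, add_zero] at hF
  rw [hF]
  ring

end Primitive

/-- Grönwall's inequality in integral form. -/
theorem le_mul_exp_of_le_add_integral {E : ℝ → ℝ} {a c T : ℝ} (hc : 0 < c)
    (hE : ContinuousOn E (Icc 0 T))
    (h : ∀ t ∈ Icc 0 T, E t ≤ a + c * ∫ s in (0 : ℝ)..t, E s) :
    ∀ t ∈ Icc 0 T, E t ≤ a * Real.exp (c * t) := by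
  intro t ht
  have hT : 0 ≤ T := ht.1.trans ht.2
  have hi : IntervalIntegrable E volume 0 T := by
    refine ContinuousOn.intervalIntegrable ?_
    rwa [uIcc_of_le hT]
  have hcont : ContinuousOn (fun x => ∫ s in (0 : ℝ)..x, E s) (Icc 0 T) := by
    have h1 := intervalIntegral.continuousOn_primitive_interval
      ((intervalIntegrable_iff' (by simp)).1 hi)
    rwa [uIcc_of_le hT] at h1
  have hder : ∀ x ∈ Ico 0 T,
      HasDerivWithinAt (fun x => ∫ s in (0 : ℝ)..x, E s) (E x) (Ici x) x := by
    intro x hx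
    have hnhds : Icc 0 T ∈ nhdsWithin x (Ioi x) :=
      Filter.mem_of_superset (Ioo_mem_nhdsGT hx.2) fun y hy => ⟨hx.1.trans hy.1.le, hy.2.le⟩
    refine intervalIntegral.integral_hasDerivWithinAt_right (t := Ioi x)
      (hi.mono_set (uIcc_subset_uIcc (by simp) (by
        rw [uIcc_of_le hT]; exact ⟨hx.1, hx.2.le⟩))) ?_ ?_
    · exact ⟨Icc 0 T, hnhds, hE.aestronglyMeasurable measurableSet_Icc⟩
    · exact (hE x ⟨hx.1, hx.2.le⟩).mono_of_mem_nhdsWithin hnhds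
  -- E need not be differentiable, so the differential Grönwall inequality is applied to its
  -- primitive G: G(0) = 0 and G' = E ≤ cG + a. The bound on G is then put back into E ≤ a + cG.
  have hG := le_gronwallBound_of_liminf_deriv_right_le (δ := 0) (K := c) (ε := a) hcont
    (fun x hx r hr => (hder x hx).liminf_right_slope_le hr) (by simp)
    (fun x hx => by linarith [h x ⟨hx.1, hx.2.le⟩]) t ht
  rw [gronwallBound_of_K_ne_0 hc.ne'] at hG
  have h2 := mul_le_mul_of_nonneg_left hG hc.le
  have h3 : c * (0 * Real.exp (c * (t - 0)) + a / c * (Real.exp (c * (t - 0)) - 1)) =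
      a * Real.exp (c * t) - a := by
    field_simp
    ring_nf
  linarith [h t ht]

/-- Grönwall's inequality for an energy `E` with a dissipation `D` and a source `g`. -/
theorem energy_dissipation_le {E D g : ℝ → ℝ} {e c T : ℝ} (hT : 0 ≤ T) (hc : 0 < c)
    (hE : ContinuousOn E (Icc 0 T)) (hE0 : ∀ t, 0 ≤ E t)
    (hD0 : ∀ t, 0 ≤ D t)
    (hg : IntervalIntegrable g volume 0 T) (hg0 : ∀ t, 0 ≤ g t)
    (h : ∀ t ∈ Icc 0 T, E t + ∫ s in (0 : ℝ)..t, D s ≤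
      e + ∫ s in (0 : ℝ)..t, (c * E s + g s)) :
    (∀ t ∈ Icc 0 T, E t ≤ (e + ∫ s in (0 : ℝ)..T, g s) * Real.exp (c * T)) ∧
      ∫ s in (0 : ℝ)..T, D s ≤
        (e + ∫ s in (0 : ℝ)..T, g s) * (1 + c * T * Real.exp (c * T)) := by
  have hi : IntervalIntegrable E volume 0 T := by
    refine ContinuousOn.intervalIntegrable ?_
    rwa [uIcc_of_le hT]
  have hsub : ∀ {f : ℝ → ℝ}, IntervalIntegrable f volume 0 T → ∀ t ∈ Icc 0 T,
      IntervalIntegrable f volume 0 t := fun hf t ht =>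
    hf.mono_set (uIcc_subset_uIcc (by simp) (by rwa [uIcc_of_le hT]))
  have h1 : ∀ t ∈ Icc 0 T, E t + ∫ s in (0 : ℝ)..t, D s ≤
      (e + ∫ s in (0 : ℝ)..T, g s) + c * ∫ s in (0 : ℝ)..t, E s := by
    intro t ht
    have h2 := h t ht
    rw [intervalIntegral.integral_add ((hsub hi t ht).const_mul c) (hsub hg t ht),
      intervalIntegral.integral_const_mul] at h2
    -- Since g ≥ 0, its integral may be extended up to T, which makes the free term constant in t.
    have h3 := intervalIntegral.integral_mono_interval le_rfl ht.1 ht.2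
      (.of_forall hg0) hg
    linarith
  have hDt : ∀ t ∈ Icc 0 T, 0 ≤ ∫ s in (0 : ℝ)..t, D s := fun t ht =>
    intervalIntegral.integral_nonneg ht.1 fun s _ => hD0 s
  have ha : 0 ≤ e + ∫ s in (0 : ℝ)..T, g s := by
    have h2 := h1 0 ⟨le_rfl, hT⟩
    simp only [intervalIntegral.integral_same, mul_zero, add_zero] at h2
    exact (hE0 0).trans h2
  have hEb : ∀ t ∈ Icc 0 T, E t ≤ (e + ∫ s in (0 : ℝ)..T, g s) * Real.exp (c * T) := by
    intro t ht
    have h2 := le_mul_exp_of_le_add_integral (a := e + ∫ s in (0 : ℝ)..T, g s) hc hE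
      (fun t ht => by linarith [h1 t ht, hDt t ht]) t ht
    have := ht.2
    exact h2.trans (by gcongr)
  refine ⟨hEb, ?_⟩
  have h4 : ∫ s in (0 : ℝ)..T, E s ≤
      ∫ _ in (0 : ℝ)..T, (e + ∫ s in (0 : ℝ)..T, g s) * Real.exp (c * T) :=
    intervalIntegral.integral_mono_on hT hi (by simp) hEb
  rw [intervalIntegral.integral_const, smul_eq_mul, sub_zero] at h4
  have h5 := h1 T ⟨hT, le_rfl⟩
  have h6 := mul_le_mul_of_nonneg_left h4 hc.le
  nlinarith [hE0 T]

namespace PhaseField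

variable {Ω : Set E3} {T : ℝ}

/-! ### The spaces `V` and `W` -/

/-- The Dirichlet energy `‖∇u‖²`. -/
noncomputable def H1.dirichlet (u : H1 Ω) : ℝ := ∑ i : Fin 3, ‖H1.partialD i u‖ ^ 2

theorem H1.dirichlet_nonneg (u : H1 Ω) : 0 ≤ u.dirichlet :=
  Finset.sum_nonneg fun _ _ => sq_nonneg _

theorem H1.norm_sq (u : H1 Ω) : ‖u‖ ^ 2 = ‖H1.toL2 u‖ ^ 2 + u.dirichlet := by
  change ‖u.1‖ ^ 2 = _
  rw [WithLp.prod_norm_sq_eq_of_L2, PiLp.norm_sq_eq_of_L2]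
  rfl

theorem H2.norm_sq (u : H2 Ω) :
    ‖u‖ ^ 2 = ‖H2.toH1 u‖ ^ 2 + ∑ p : Fin 3 × Fin 3, ‖H2.partialD2 p.1 p.2 u‖ ^ 2 := by
  change ‖u.1‖ ^ 2 = _
  rw [WithLp.prod_norm_sq_eq_of_L2, PiLp.norm_sq_eq_of_L2]
  rfl

theorem H1.norm_toL2_le (u : H1 Ω) : ‖H1.toL2 u‖ ≤ ‖u‖ :=
  le_of_sq_le_sq (by linarith [u.norm_sq, u.dirichlet_nonneg]) (norm_nonneg _)

theorem H2.norm_toH1_le (u : H2 Ω) : ‖H2.toH1 u‖ ≤ ‖u‖ := by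
  have h : 0 ≤ ∑ p : Fin 3 × Fin 3, ‖H2.partialD2 p.1 p.2 u‖ ^ 2 := by positivity
  exact le_of_sq_le_sq (by linarith [u.norm_sq]) (norm_nonneg _)

theorem H2.norm_partialD2_le (u : H2 Ω) (i j : Fin 3) : ‖H2.partialD2 i j u‖ ≤ ‖u‖ := by
  have h := Finset.single_le_sum (f := fun p : Fin 3 × Fin 3 => ‖H2.partialD2 p.1 p.2 u‖ ^ 2)
    (fun _ _ => sq_nonneg _) (Finset.mem_univ (i, j))
  exact le_of_sq_le_sq (by linarith [u.norm_sq, sq_nonneg ‖H2.toH1 u‖]) (norm_nonneg _)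

theorem W.norm_laplacian_le (w : W Ω) : ‖W.laplacian w‖ ≤ 3 * ‖w‖ := by
  have h : W.laplacian w = ∑ i : Fin 3, H2.partialD2 i i (W.toH2 w) := by
    simp [W.laplacian, H2.laplacian]
  rw [h]
  refine (norm_sum_le _ _).trans ((Finset.sum_le_card_nsmul _ _ ‖w‖ fun i _ =>
    H2.norm_partialD2_le (W.toH2 w) i i).trans ?_)
  simp

/-- The continuous inclusion `W → H¹(Ω)`. -/
noncomputable def W.toH1 : W Ω →L[ℝ] H1 Ω :=
  (H2.toH1 ∘ₗ W.toH2).mkContinuous 1 fun w => by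
    rw [one_mul]
    exact H2.norm_toH1_le (W.toH2 w)

theorem W.toL2_eq (w : W Ω) : W.toL2 w = H1.toL2 (W.toH1 w) := rfl

theorem W.norm_toL2_le (w : W Ω) : ‖W.toL2 w‖ ≤ ‖w‖ :=
  (H1.norm_toL2_le _).trans (H2.norm_toH1_le (W.toH2 w))

/-- Green's formula on `W`. -/
theorem W.inner_laplacian (w : W Ω) (v : H1 Ω) :
    ⟪W.laplacian w, H1.toL2 v⟫ =
      -∑ i : Fin 3, ⟪H1.partialD i (W.toH1 w), H1.partialD i v⟫ :=
  -- Membership in `W` means that the functional defined through Green's formula vanishes on every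
  -- v, so no trace is needed.
  eq_neg_of_add_eq_zero_right (w.2 v)

theorem W.inner_laplacian_self (w : W Ω) :
    ⟪W.laplacian w, W.toL2 w⟫ = -(W.toH1 w).dirichlet := by
  rw [W.toL2_eq, W.inner_laplacian]
  simp only [real_inner_self_eq_norm_sq, H1.dirichlet]

/-- This is Young's inequality for the cross term 2a∫∇p·∇w, from ‖∂ᵢw - a∂ᵢp‖² ≥ 0 in each
component. After multiplication by k, each summand is half of the dissipation available for it. -/
theorem W.neg_mul_inner_laplacian_le (w p : W Ω) (a : ℝ) :
    -(2 * a * ⟪W.laplacian p, W.toL2 w⟫) ≤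
      (W.toH1 w).dirichlet + a ^ 2 * (W.toH1 p).dirichlet := by
  rw [W.toL2_eq, W.inner_laplacian, H1.dirichlet, H1.dirichlet, mul_neg, neg_neg,
    Finset.mul_sum, Finset.mul_sum, ← Finset.sum_add_distrib]
  refine Finset.sum_le_sum fun i _ => ?_
  have h := sq_nonneg ‖H1.partialD i (W.toH1 w) - a • H1.partialD i (W.toH1 p)‖
  rw [norm_sub_sq_real, norm_smul, mul_pow, Real.norm_eq_abs, sq_abs, real_inner_smul_right,
    real_inner_comm] at h
  linarith

/-! ### Subdifferentials -/

theorem IsConvexPotential.subdifferential_monotone {βhat : ℝ → ℝ≥0∞} (hβ : IsConvexPotential βhat)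
    {r s ξ η : ℝ} (hξ : ξ ∈ subdifferential βhat r) (hη : η ∈ subdifferential βhat s) :
    0 ≤ (ξ - η) * (r - s) := by
  -- Testing the subgradient inequality at 0, where the potential vanishes, excludes the value ∞.
  -- The two subgradient inequalities can then be added in ℝ.
  have hfin : ∀ {r ξ : ℝ}, ξ ∈ subdifferential βhat r → βhat r ≠ ⊤ := by
    intro r ξ h htop
    have h0 := h 0
    rw [htop, hβ.zero, EReal.coe_ennreal_top, EReal.top_add_coe] at h0
    simp at h0
  have h1 := hξ s
  have h2 := hη r
  lift βhat r to ℝ≥0 using hfin hξ with a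
  lift βhat s to ℝ≥0 using hfin hη with b
  have h1 : (((a : ℝ) + ξ * (s - r) : ℝ) : EReal) ≤ ((b : ℝ) : EReal) := h1
  have h2 : (((b : ℝ) + η * (r - s) : ℝ) : EReal) ≤ ((a : ℝ) : EReal) := h2
  rw [EReal.coe_le_coe_iff] at h1 h2
  linarith

/-! ### Slices of functions in `L²(Q)` -/

theorem integral_norm_sq (f : L2Q Ω T) :
    ∫ t, ∫ x, ‖f (t, x)‖ ^ 2 ∂volume.restrict Ω ∂timeMeasure T = ‖f‖ ^ 2 := by
  have hi := (memLp_two_iff_integrable_sq_norm (Lp.memLp f).1).1 (Lp.memLp f)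
  rw [← integral_prod (fun z => ‖f z‖ ^ 2) hi, ← real_inner_self_eq_norm_sq f, L2.inner_def]
  simp only [real_inner_self_eq_norm_sq]

theorem integrable_slice_norm_sq (f : L2Q Ω T) :
    Integrable (fun t => ∫ x, ‖f (t, x)‖ ^ 2 ∂volume.restrict Ω) (timeMeasure T) :=
  ((memLp_two_iff_integrable_sq_norm (Lp.memLp f).1).1 (Lp.memLp f)).integral_prod_left

/-- Almost every time slice of a function in `L²(Q)` is in `L²(Ω)`. -/
theorem ae_exists_slice (f : L2Q Ω T) :
    ∀ᵐ t ∂timeMeasure T, ∃ g : L2 Ω, (∀ᵐ x ∂volume.restrict Ω, g x = f (t, x)) ∧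
      ‖g‖ ^ 2 = ∫ x, ‖f (t, x)‖ ^ 2 ∂volume.restrict Ω := by
  have hi := (memLp_two_iff_integrable_sq_norm (Lp.memLp f).1).1 (Lp.memLp f)
  filter_upwards [hi.prod_right_ae, (Lp.memLp f).1.prodMk_left] with t h1 h2
  have hm : MemLp (fun x => f (t, x)) 2 (volume.restrict Ω) :=
    (memLp_two_iff_integrable_sq_norm h2).2 h1
  refine ⟨hm.toLp _, hm.coeFn_toLp, ?_⟩
  rw [← real_inner_self_eq_norm_sq (hm.toLp _), L2.inner_def]
  refine integral_congr_ae ?_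
  filter_upwards [hm.coeFn_toLp] with x hx
  rw [hx, real_inner_self_eq_norm_sq]

theorem ae_ae_sub (f g : L2Q Ω T) :
    ∀ᵐ t ∂timeMeasure T, ∀ᵐ x ∂volume.restrict Ω, (f - g) (t, x) = f (t, x) - g (t, x) :=
  Measure.ae_ae_of_ae_prod (Lp.coeFn_sub f g)

/-! ### Energy estimates in time -/

theorem integrable_real_inner {α H : Type*} [MeasurableSpace α] {μ : Measure α}
    [NormedAddCommGroup H] [InnerProductSpace ℝ H] {f g : α → H} (hf : MemLp f 2 μ)
    (hg : MemLp g 2 μ) : Integrable (fun t => ⟪f t, g t⟫) μ := by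
  refine (L2.integrable_inner (𝕜 := ℝ) (hf.toLp f) (hg.toLp g)).congr ?_
  filter_upwards [hf.coeFn_toLp, hg.coeFn_toLp] with t h1 h2
  rw [h1, h2]

theorem intervalIntegrable_of_timeMeasure {H : Type*} [NormedAddCommGroup H] {g : ℝ → H}
    (hT : 0 ≤ T) (hg : Integrable g (timeMeasure T)) : IntervalIntegrable g volume 0 T :=
  (intervalIntegrable_iff_integrableOn_Ioo_of_le hT).2 hg

theorem intervalIntegral_eq_timeMeasure {g : ℝ → ℝ} (hT : 0 ≤ T) :
    ∫ t in (0 : ℝ)..T, g t = ∫ t, g t ∂timeMeasure T := by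
  rw [intervalIntegral.integral_of_le hT, integral_Ioc_eq_integral_Ioo]

theorem HasTimeDeriv.integrable {u u' : ℝ → L2 Ω} (h : HasTimeDeriv T u u') :
    Integrable u' (timeMeasure T) :=
  h.memLp.integrable one_le_two

theorem HasTimeDeriv.sub {u u' v v' : ℝ → L2 Ω} (hu : HasTimeDeriv T u u')
    (hv : HasTimeDeriv T v v') : HasTimeDeriv T (u - v) (u' - v') := by
  refine ⟨hu.memLp.sub hv.memLp, fun t ht => ?_⟩
  have hT := ht.1.trans ht.2
  have hsub : uIcc 0 t ⊆ uIcc 0 T := uIcc_subset_uIcc (by simp) (by rwa [uIcc_of_le hT])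
  simp only [Pi.sub_apply]
  rw [intervalIntegral.integral_sub
    ((intervalIntegrable_of_timeMeasure hT hu.integrable).mono_set hsub)
    ((intervalIntegrable_of_timeMeasure hT hv.integrable).mono_set hsub),
    hu.eq_integral t ht, hv.eq_integral t ht]
  abel

theorem HasTimeDeriv.continuousOn {u u' : ℝ → L2 Ω} (hT : 0 ≤ T) (h : HasTimeDeriv T u u') :
    ContinuousOn u (Icc 0 T) :=
  continuousOn_of_eq_primitive hT (intervalIntegrable_of_timeMeasure hT h.integrable)
    h.eq_integral

theorem HasTimeDeriv.norm_sq_eq {u u' : ℝ → L2 Ω} (h : HasTimeDeriv T u u') {t : ℝ}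
    (ht : t ∈ Icc 0 T) :
    ‖u t‖ ^ 2 = ‖u 0‖ ^ 2 + ∫ s in (0 : ℝ)..t, 2 * ⟪u' s, u s⟫ := by
  have hT := ht.1.trans ht.2
  refine norm_sq_eq_of_eq_primitive ht.1 ?_ fun s hs => h.eq_integral s ⟨hs.1, hs.2.trans ht.2⟩
  exact (intervalIntegrable_of_timeMeasure hT h.integrable).mono_set
    (uIcc_subset_uIcc (by simp) (by rwa [uIcc_of_le hT]))

/-- The continuous inclusion `H¹(Ω) → L²(Ω)`. -/
noncomputable def H1.toL2CLM : H1 Ω →L[ℝ] L2 Ω :=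
  H1.toL2.mkContinuous 1 fun u => by
    rw [one_mul]
    exact u.norm_toL2_le

theorem integrable_norm_sq {H : Type*} [NormedAddCommGroup H] {v : ℝ → H}
    (hv : MemLp v 2 (timeMeasure T)) : Integrable (fun t => ‖v t‖ ^ 2) (timeMeasure T) :=
  (memLp_two_iff_integrable_sq_norm hv.1).1 hv

theorem integrable_dirichlet {v : ℝ → H1 Ω} (hv : MemLp v 2 (timeMeasure T)) :
    Integrable (fun t => (v t).dirichlet) (timeMeasure T) := by
  refine ((integrable_norm_sq hv).sub (integrable_norm_sq
    (H1.toL2CLM.comp_memLp' hv))).congr (.of_forall fun t => ?_)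
  change ‖v t‖ ^ 2 - ‖H1.toL2 (v t)‖ ^ 2 = _
  linarith [(v t).norm_sq]

theorem IsLift.memLp_toL2 {u : ℝ → L2 Ω} {v : ℝ → H1 Ω} (hl : IsLift T H1.toL2 u v)
    (hv : MemLp v 2 (timeMeasure T)) : MemLp u 2 (timeMeasure T) :=
  (H1.toL2CLM.comp_memLp' hv).ae_eq hl

/-- The integrated form of a pointwise energy inequality. -/
theorem energy_estimate (hT : 0 ≤ T) {M a b c : ℝ} (hM : 0 ≤ M) (ha : 0 ≤ a) (hb : 0 ≤ b)
    (hc : 0 < c) {u u' p p' : ℝ → L2 Ω} {v q : ℝ → H1 Ω} {g : ℝ → ℝ}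
    (hu : HasTimeDeriv T u u') (hp : HasTimeDeriv T p p')
    (hv : MemLp v 2 (timeMeasure T)) (hq : MemLp q 2 (timeMeasure T))
    (huv : IsLift T H1.toL2 u v) (hpq : IsLift T H1.toL2 p q)
    (hg : Integrable g (timeMeasure T)) (hg0 : ∀ t, 0 ≤ g t)
    (h : ∀ᵐ t ∂timeMeasure T, 2 * ⟪u' t, u t⟫ + M * (2 * ⟪p' t, p t⟫) +
      (a * (v t).dirichlet + b * (q t).dirichlet) ≤ c * (‖u t‖ ^ 2 + M * ‖p t‖ ^ 2) + g t) :
    (∀ t ∈ Icc 0 T, ‖u t‖ ^ 2 + M * ‖p t‖ ^ 2 ≤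
      (‖u 0‖ ^ 2 + M * ‖p 0‖ ^ 2 + ∫ s, g s ∂timeMeasure T) * Real.exp (c * T)) ∧
    a * ∫ s, (v s).dirichlet ∂timeMeasure T + b * ∫ s, (q s).dirichlet ∂timeMeasure T ≤
      (‖u 0‖ ^ 2 + M * ‖p 0‖ ^ 2 + ∫ s, g s ∂timeMeasure T) *
        (1 + c * T * Real.exp (c * T)) := by
  have hDv := (integrable_dirichlet hv).const_mul a
  have hDq := (integrable_dirichlet hq).const_mul b
  have hiu := (integrable_real_inner hu.memLp (huv.memLp_toL2 hv)).const_mul 2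
  have hip := ((integrable_real_inner hp.memLp (hpq.memLp_toL2 hq)).const_mul 2).const_mul M
  have hD : Integrable (fun t => a * (v t).dirichlet + b * (q t).dirichlet) (timeMeasure T) :=
    hDv.add hDq
  have hE : Integrable (fun t => c * (‖u t‖ ^ 2 + M * ‖p t‖ ^ 2)) (timeMeasure T) :=
    ((integrable_norm_sq (huv.memLp_toL2 hv)).add
    ((integrable_norm_sq (hpq.memLp_toL2 hq)).const_mul M)).const_mul c
  have key := energy_dissipation_le (E := fun t => ‖u t‖ ^ 2 + M * ‖p t‖ ^ 2)
    (D := fun t => a * (v t).dirichlet + b * (q t).dirichlet) (g := g)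
    (e := ‖u 0‖ ^ 2 + M * ‖p 0‖ ^ 2) hT hc
    (((hu.continuousOn hT).norm.pow 2).add
      (continuousOn_const.mul ((hp.continuousOn hT).norm.pow 2)))
    (fun t => by positivity)
    (fun t => add_nonneg (mul_nonneg ha (v t).dirichlet_nonneg)
      (mul_nonneg hb (q t).dirichlet_nonneg))
    (intervalIntegrable_of_timeMeasure hT hg) hg0 ?_
  · rwa [intervalIntegral_eq_timeMeasure hT, intervalIntegral_eq_timeMeasure hT,
      integral_add hDv hDq, integral_const_mul, integral_const_mul] at key
  intro t ht
  have hII : ∀ {f : ℝ → ℝ}, Integrable f (timeMeasure T) → IntervalIntegrable f volume 0 t :=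
    fun hf => (intervalIntegrable_of_timeMeasure hT hf).mono_set
      (uIcc_subset_uIcc (by simp) (by rwa [uIcc_of_le hT]))
  have hmono := intervalIntegral.integral_mono_ae_restrict ht.1
    (((hII hiu).add (hII hip)).add (hII hD)) ((hII hE).add (hII hg)) (by
      rw [Filter.EventuallyLE, Measure.restrict_congr_set (Ioo_ae_eq_Icc (a := (0 : ℝ)) (b := t)).symm]
      exact ae_mono (Measure.restrict_mono (Ioo_subset_Ioo_right ht.2) le_rfl) h)
  have h1 := hu.norm_sq_eq ht
  have h2 := hp.norm_sq_eq ht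
  rw [intervalIntegral.integral_add ((hII hiu).add (hII hip)) (hII hD),
    intervalIntegral.integral_add (hII hiu) (hII hip),
    intervalIntegral.integral_const_mul M] at hmono
  rw [h1, h2]
  linarith

/-- A bound for the norm of `L^∞(0, T; H) ∩ L²(0, T; V)`. -/
theorem energyNorm_le {u : ℝ → L2 Ω} {v : ℝ → H1 Ω} (hT : 0 ≤ T)
    (hv : MemLp v 2 (timeMeasure T)) (hl : IsLift T H1.toL2 u v) {B G : ℝ}
    (hu : ∀ t ∈ Icc 0 T, ‖u t‖ ^ 2 ≤ B)
    (hG : ∫ t, (v t).dirichlet ∂timeMeasure T ≤ G) :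
    energyNorm T u ≤ ENNReal.ofReal (√B + √(T * B + G)) := by
  rw [ENNReal.ofReal_add (Real.sqrt_nonneg _) (Real.sqrt_nonneg _)]
  have hae : ∀ᵐ t ∂timeMeasure T, ‖u t‖ ^ 2 ≤ B :=
    (ae_restrict_mem measurableSet_Ioo).mono fun t ht => hu t (Ioo_subset_Icc_self ht)
  -- `bochnerNorm` is an infimum over lifts, so the given lift v bounds it.
  refine add_le_add ?_ ((iInf₂_le v hl).trans ?_)
  · rw [eLpNorm_exponent_top]
    exact eLpNormEssSup_le_of_ae_bound (hae.mono fun t ht => Real.le_sqrt_of_sq_le ht)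
  · rw [hv.eLpNorm_eq_integral_rpow_norm two_ne_zero ENNReal.ofNat_ne_top]
    refine ENNReal.ofReal_le_ofReal ?_
    simp only [ENNReal.toReal_ofNat, Real.rpow_two]
    rw [Real.sqrt_eq_rpow, one_div]
    refine Real.rpow_le_rpow (integral_nonneg fun t => by positivity) ?_ (by norm_num)
    have h1 : ∫ t, ‖v t‖ ^ 2 ∂timeMeasure T ≤
        ∫ t, (B + (v t).dirichlet) ∂timeMeasure T := by
      refine integral_mono_ae (integrable_norm_sq hv)
        ((integrable_const B).add (integrable_dirichlet hv)) ?_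
      filter_upwards [hae, hl] with t h1 h2
      rw [(v t).norm_sq, h2]
      linarith
    rw [integral_add (integrable_const B) (integrable_dirichlet hv), integral_const] at h1
    simp [hT] at h1
    linarith

/-! ### The difference of two solutions -/

/-- One template for passing between identities in `Lp` and identities a.e.; shorter combinations
are obtained by inserting zeros. -/
theorem coeFn_linear_combination {α : Type*} [MeasurableSpace α] {μ : Measure α} {q : ℝ≥0∞}
    (a b c d : Lp ℝ q μ) (k m : ℝ) :
    ∀ᵐ x ∂μ, (a - k • b + m • c + d : Lp ℝ q μ) x = a x - k * b x + m * c x + d x := by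
  filter_upwards [Lp.coeFn_add (a - k • b + m • c) d, Lp.coeFn_add (a - k • b) (m • c),
    Lp.coeFn_sub a (k • b), Lp.coeFn_smul k b, Lp.coeFn_smul m c] with x h1 h2 h3 h4 h5
  simp only [h1, h2, h3, h4, h5, Pi.add_apply, Pi.sub_apply, Pi.smul_apply, smul_eq_mul]

/-- The equations of the problem as identities in `L²(Ω)` at almost every time. -/
theorem SolvesWith.ae_equations {P : Parameters} (hαℓ : P.alpha = P.ell) {βhat : ℝ → ℝ≥0∞}
    {πhat : ℝ → ℝ} {A : L2 Ω → Set (L2 Ω)} {d : Data Ω T} {η φ η' φ' : ℝ → L2 Ω}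
    {ηW φW : ℝ → W Ω} {ζ : ℝ → L2 Ω} {ξ : L2Q Ω T}
    (h : SolvesWith P βhat πhat A d η φ η' φ' ηW φW ζ ξ) :
    ∀ᵐ t ∂timeMeasure T, ∃ F X R : L2 Ω,
      (∀ᵐ x ∂volume.restrict Ω, F x = d.f (t, x)) ∧
      (∀ᵐ x ∂volume.restrict Ω, X x ∈ subdifferential βhat (φ t x)) ∧
      (∀ᵐ x ∂volume.restrict Ω, R x = deriv πhat (φ t x)) ∧
      η' t - P.k • W.laplacian (ηW t) + (P.k * P.alpha) • W.laplacian (φW t) + ζ t =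
        F - P.k • W.laplacian d.etaStar ∧
      φ' t - P.nu • W.laplacian (φW t) + X + R =
        P.gamma • (η t - P.alpha • φ t + W.toL2 d.etaStar) := by
  filter_upwards [h.eq_eta, h.eq_phi, h.xi_mem, ae_exists_slice d.f, ae_exists_slice ξ]
    with t e1 e2 hξ ⟨F, hF, _⟩ ⟨X, hX, _⟩
  -- R is taken to be the residual of the second equation. It is thus in L² by construction and the
  -- equation holds trivially; only its identification with π(φ) a.e. has to be checked.
  refine ⟨F, X, P.gamma • (η t - P.alpha • φ t + W.toL2 d.etaStar) -
    (φ' t - P.nu • W.laplacian (φW t) + X), hF, ?_, ?_, ?_, add_sub_cancel _ _⟩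
  · filter_upwards [hX, hξ] with x h1 h2
    rwa [h1]
  · generalize W.laplacian (φW t) = l at *
    generalize W.toL2 d.etaStar = s at *
    filter_upwards [e2, hX, Lp.coeFn_sub (P.gamma • (η t - P.alpha • φ t + s))
      (φ' t - P.nu • l + X), Lp.coeFn_smul P.gamma (η t - P.alpha • φ t + s),
      coeFn_linear_combination (η t) (φ t) 0 s P.alpha 0,
      coeFn_linear_combination (φ' t) l 0 X P.nu 0] with x h1 h2 h3 h4 h5 h6
    simp only [zero_smul, add_zero, zero_mul] at h5 h6
    rw [h3, Pi.sub_apply, h4, Pi.smul_apply, smul_eq_mul, h5, h6, h2]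
    linarith
  · generalize W.laplacian (φW t) = l at *
    generalize W.laplacian (ηW t) = m at *
    generalize W.laplacian d.etaStar = s at *
    refine Lp.ext ?_
    filter_upwards [e1, hF, coeFn_linear_combination (η' t) m l (ζ t) P.k (P.k * P.alpha),
      coeFn_linear_combination F s 0 0 P.k 0, Lp.coeFn_zero ℝ 2 (volume.restrict Ω)]
      with x h1 h2 h3 h4 h5
    simp only [zero_smul, add_zero, zero_mul, h5, Pi.zero_apply] at h4
    -- The assumption α = ℓ enters here: the coefficient of ∂ₜφ becomes zero.
    rw [h3, h4, h2, ← h1, hαℓ]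
    ring

/-- The energy inequality at a fixed time: the first equation tested with `w`, the second with
`M p`, where `M = k α² / ν`. -/
theorem energy_inequality {H : Type*} [NormedAddCommGroup H] [InnerProductSpace ℝ H]
    {k α ν γ L M : ℝ} (hk : 0 < k) (hγ : 0 < γ) (hM : 0 < M) (hL : 0 ≤ L)
    (hMν : M * ν = k * α ^ 2) (hα : 0 < α) {w p s lw lp ls w' p' z x r F : H} {gw gp σ : ℝ}
    (hw : ⟪lw, w⟫ = -gw) (hp : ⟪lp, p⟫ = -gp)
    (hpw : -(2 * α * ⟪lp, w⟫) ≤ gw + α ^ 2 * gp) (hls : ‖ls‖ ≤ 3 * σ) (hs : ‖s‖ ≤ σ)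
    (h1 : w' - k • lw + (k * α) • lp + z = F - k • ls)
    (h2 : p' - ν • lp + x + r = γ • (w - α • p + s))
    (hz : 0 ≤ ⟪z, w⟫) (hx : 0 ≤ ⟪x, p⟫) (hr : ‖r‖ ≤ L * ‖p‖) :
    2 * ⟪w', w⟫ + M * (2 * ⟪p', p⟫) + (k * gw + k * α ^ 2 * gp) ≤
    (2 + M * γ + 2 * L + 2 * γ) * (‖w‖ ^ 2 + M * ‖p‖ ^ 2) +
      (‖F‖ ^ 2 + (9 * k ^ 2 + M * γ) * σ ^ 2) := by
  have e1 := congrArg (fun y => ⟪y, w⟫) h1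
  have e2 := congrArg (fun y => ⟪y, p⟫) h2
  simp only [inner_add_left, inner_sub_left, real_inner_smul_left, hw, hp,
    real_inner_self_eq_norm_sq] at e1 e2
  have c2 := real_inner_le_norm F w
  have c3 := (abs_le.1 (abs_real_inner_le_norm ls w)).1
  have c4 := (abs_le.1 (abs_real_inner_le_norm r p)).1
  have c5 := real_inner_le_norm w p
  have c6 := real_inner_le_norm s p
  have c7 := mul_le_mul_of_nonneg_right hls (norm_nonneg w)
  have c8 := mul_le_mul_of_nonneg_right hr (norm_nonneg p)
  have c9 := mul_le_mul_of_nonneg_right hs (norm_nonneg p)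
  have f1 : 2 * ⟪w', w⟫ ≤
      ‖F‖ ^ 2 + 9 * k ^ 2 * σ ^ 2 + 2 * ‖w‖ ^ 2 - k * gw + k * α ^ 2 * gp := by
    have t1 := mul_le_mul_of_nonneg_left hpw hk.le
    have t2 : k * -⟪ls, w⟫ ≤ k * (3 * σ * ‖w‖) := mul_le_mul_of_nonneg_left (by linarith) hk.le
    linarith [sq_nonneg (‖F‖ - ‖w‖), sq_nonneg (3 * k * σ - ‖w‖)]
  have f2 : 2 * ⟪p', p⟫ ≤
      -(2 * ν * gp) + (2 * L + 2 * γ) * ‖p‖ ^ 2 + γ * ‖w‖ ^ 2 + γ * σ ^ 2 := by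
    have t1 := mul_le_mul_of_nonneg_left c5 hγ.le
    have t2 := mul_le_mul_of_nonneg_left (c6.trans c9) hγ.le
    linarith [mul_nonneg hγ.le (sq_nonneg (‖w‖ - ‖p‖)), mul_nonneg hγ.le (sq_nonneg (σ - ‖p‖)),
      mul_nonneg (mul_pos hγ hα).le (sq_nonneg ‖p‖)]
  have f3 := mul_le_mul_of_nonneg_left f2 hM.le
  have f4 : M * (2 * ν * gp) = 2 * (k * α ^ 2) * gp := by
    rw [← hMν]
    ring
  -- The estimates give the coefficient 2 + Mγ for ‖w‖² and 2L + 2γ for M‖p‖². These nonnegative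
  -- terms fill the gap to the common constant, the sum of the two.
  have f5 : 0 ≤ M * γ * (M * ‖p‖ ^ 2) := by positivity
  have f6 : 0 ≤ (2 * L + 2 * γ) * ‖w‖ ^ 2 := by positivity
  have f7 : 0 ≤ 2 * (M * ‖p‖ ^ 2) := by positivity
  linarith

theorem eta_equation_sub {H : Type*} [AddCommGroup H] [Module ℝ H] {k m : ℝ}
    {a₁ a₂ b₁ b₂ c₁ c₂ z₁ z₂ F₁ F₂ s₁ s₂ : H}
    (h₁ : a₁ - k • b₁ + m • c₁ + z₁ = F₁ - k • s₁)
    (h₂ : a₂ - k • b₂ + m • c₂ + z₂ = F₂ - k • s₂) :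
    a₁ - a₂ - k • (b₁ - b₂) + m • (c₁ - c₂) + (z₁ - z₂) = F₁ - F₂ - k • (s₁ - s₂) := by
  linear_combination (norm := module) h₁ - h₂

theorem phi_equation_sub {H : Type*} [AddCommGroup H] [Module ℝ H] {ν γ α : ℝ}
    {a₁ a₂ b₁ b₂ x₁ x₂ r₁ r₂ w₁ w₂ p₁ p₂ s₁ s₂ : H}
    (h₁ : a₁ - ν • b₁ + x₁ + r₁ = γ • (w₁ - α • p₁ + s₁))
    (h₂ : a₂ - ν • b₂ + x₂ + r₂ = γ • (w₂ - α • p₂ + s₂)) :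
    a₁ - a₂ - ν • (b₁ - b₂) + (x₁ - x₂) + (r₁ - r₂) =
      γ • (w₁ - w₂ - α • (p₁ - p₂) + (s₁ - s₂)) := by
  linear_combination (norm := module) h₁ - h₂

theorem IsConvexPotential.inner_sub_nonneg {βhat : ℝ → ℝ≥0∞} (hβ : IsConvexPotential βhat)
    {X₁ X₂ u₁ u₂ : L2 Ω}
    (h₁ : ∀ᵐ x ∂volume.restrict Ω, X₁ x ∈ subdifferential βhat (u₁ x))
    (h₂ : ∀ᵐ x ∂volume.restrict Ω, X₂ x ∈ subdifferential βhat (u₂ x)) :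
    0 ≤ ⟪X₁ - X₂, u₁ - u₂⟫ := by
  rw [L2.inner_def]
  refine integral_nonneg_of_ae ?_
  filter_upwards [h₁, h₂, Lp.coeFn_sub X₁ X₂, Lp.coeFn_sub u₁ u₂] with y m₁ m₂ e₁ e₂
  have := hβ.subdifferential_monotone m₁ m₂
  rw [e₁, e₂]
  change 0 ≤ (u₁ y - u₂ y) * (X₁ y - X₂ y)
  linarith

theorem norm_sub_le_of_ae_eq_comp {g : ℝ → ℝ} {L : ℝ≥0} (hg : LipschitzWith L g)
    {R₁ R₂ u₁ u₂ : L2 Ω} (h₁ : ∀ᵐ x ∂volume.restrict Ω, R₁ x = g (u₁ x))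
    (h₂ : ∀ᵐ x ∂volume.restrict Ω, R₂ x = g (u₂ x)) : ‖R₁ - R₂‖ ≤ L * ‖u₁ - u₂‖ := by
  refine Lp.norm_le_mul_norm_of_ae_le_mul ?_
  filter_upwards [h₁, h₂, Lp.coeFn_sub R₁ R₂, Lp.coeFn_sub u₁ u₂] with y e₁ e₂ e₃ e₄
  rw [e₃, e₄, Pi.sub_apply, e₁, e₂, ← dist_eq_norm, Pi.sub_apply, ← dist_eq_norm]
  exact hg.dist_le_mul _ _

/-- Representatives in L²(Q) are fixed only up to null sets, so the slice of a difference is the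
difference of the slices only for a.e. t; `hf` records that t is such a time. -/
theorem eq_sub_of_ae_eq_slice {f₁ f₂ : L2Q Ω T} {t : ℝ} {F F₁ F₂ : L2 Ω}
    (hF : ∀ᵐ x ∂volume.restrict Ω, F x = (f₁ - f₂) (t, x))
    (hf : ∀ᵐ x ∂volume.restrict Ω, (f₁ - f₂) (t, x) = f₁ (t, x) - f₂ (t, x))
    (hF₁ : ∀ᵐ x ∂volume.restrict Ω, F₁ x = f₁ (t, x))
    (hF₂ : ∀ᵐ x ∂volume.restrict Ω, F₂ x = f₂ (t, x)) : F = F₁ - F₂ := by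
  refine Lp.ext ?_
  filter_upwards [hF, hf, hF₁, hF₂, Lp.coeFn_sub F₁ F₂] with x g1 g2 g3 g4 g5
  rw [g1, g2, g5, Pi.sub_apply, g3, g4]

/-- `energy_inequality` for differences of elements of `W`. -/
theorem W.energy_inequality_sub {k α ν γ L M : ℝ} (hk : 0 < k) (hγ : 0 < γ) (hM : 0 < M)
    (hL : 0 ≤ L) (hMν : M * ν = k * α ^ 2) (hα : 0 < α) {w₁ w₂ p₁ p₂ s₁ s₂ : W Ω}
    {η₁ η₂ φ₁ φ₂ w' p' z x r F : L2 Ω} (hη₁ : W.toL2 w₁ = η₁) (hη₂ : W.toL2 w₂ = η₂)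
    (hφ₁ : W.toL2 p₁ = φ₁) (hφ₂ : W.toL2 p₂ = φ₂)
    (h1 : w' - k • (W.laplacian w₁ - W.laplacian w₂) +
      (k * α) • (W.laplacian p₁ - W.laplacian p₂) + z =
        F - k • (W.laplacian s₁ - W.laplacian s₂))
    (h2 : p' - ν • (W.laplacian p₁ - W.laplacian p₂) + x + r =
      γ • (η₁ - η₂ - α • (φ₁ - φ₂) + (W.toL2 s₁ - W.toL2 s₂)))
    (hz : 0 ≤ ⟪z, η₁ - η₂⟫) (hx : 0 ≤ ⟪x, φ₁ - φ₂⟫) (hr : ‖r‖ ≤ L * ‖φ₁ - φ₂‖) :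
    2 * ⟪w', η₁ - η₂⟫ + M * (2 * ⟪p', φ₁ - φ₂⟫) +
      (k * (W.toH1 (w₁ - w₂)).dirichlet + k * α ^ 2 * (W.toH1 (p₁ - p₂)).dirichlet) ≤
    (2 + M * γ + 2 * L + 2 * γ) * (‖η₁ - η₂‖ ^ 2 + M * ‖φ₁ - φ₂‖ ^ 2) +
      (‖F‖ ^ 2 + (9 * k ^ 2 + M * γ) * ‖s₁ - s₂‖ ^ 2) := by
  subst hη₁ hη₂ hφ₁ hφ₂
  have g₁ := W.inner_laplacian_self (w₁ - w₂)
  have g₂ := W.inner_laplacian_self (p₁ - p₂)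
  have g₃ := W.neg_mul_inner_laplacian_le (w₁ - w₂) (p₁ - p₂) α
  have g₄ := W.norm_laplacian_le (s₁ - s₂)
  have g₅ := W.norm_toL2_le (s₁ - s₂)
  have m₁ : W.laplacian (w₁ - w₂) = _ := map_sub W.laplacian _ _
  have m₂ : W.laplacian (p₁ - p₂) = _ := map_sub W.laplacian _ _
  have m₃ : W.laplacian (s₁ - s₂) = _ := map_sub W.laplacian _ _
  have m₄ : W.toL2 (s₁ - s₂) = _ := map_sub W.toL2 _ _
  have m₅ : W.toL2 (w₁ - w₂) = _ := map_sub W.toL2 _ _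
  have m₆ : W.toL2 (p₁ - p₂) = _ := map_sub W.toL2 _ _
  rw [m₁, m₅] at g₁
  rw [m₂, m₆] at g₂
  rw [m₂, m₅] at g₃
  rw [m₃] at g₄
  rw [m₄] at g₅
  exact energy_inequality hk hγ hM hL hMν hα g₁ g₂ g₃ g₄ g₅ h1 h2 hz hx hr

theorem SolvesWith.ae_energy_inequality {P : Parameters} (hP : P.Positive)
    (hαℓ : P.alpha = P.ell) {βhat : ℝ → ℝ≥0∞} {πhat : ℝ → ℝ} {A : L2 Ω → Set (L2 Ω)} {L : ℝ≥0}
    (hβ : IsConvexPotential βhat) (hπ : LipschitzWith L (deriv πhat))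
    (hA : IsMaximalMonotone A) {d₁ d₂ : Data Ω T}
    {η₁ φ₁ η₁' φ₁' η₂ φ₂ η₂' φ₂' : ℝ → L2 Ω} {ηW₁ φW₁ ηW₂ φW₂ : ℝ → W Ω} {ζ₁ ζ₂ : ℝ → L2 Ω}
    {ξ₁ ξ₂ : L2Q Ω T}
    (h₁ : SolvesWith P βhat πhat A d₁ η₁ φ₁ η₁' φ₁' ηW₁ φW₁ ζ₁ ξ₁)
    (h₂ : SolvesWith P βhat πhat A d₂ η₂ φ₂ η₂' φ₂' ηW₂ φW₂ ζ₂ ξ₂) {M : ℝ} (hM : 0 < M)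
    (hMν : M * P.nu = P.k * P.alpha ^ 2) :
    ∀ᵐ t ∂timeMeasure T,
      2 * ⟪η₁' t - η₂' t, η₁ t - η₂ t⟫ + M * (2 * ⟪φ₁' t - φ₂' t, φ₁ t - φ₂ t⟫) +
        (P.k * (W.toH1 (ηW₁ t - ηW₂ t)).dirichlet +
          P.k * P.alpha ^ 2 * (W.toH1 (φW₁ t - φW₂ t)).dirichlet) ≤
      (2 + M * P.gamma + 2 * L + 2 * P.gamma) *
          (‖η₁ t - η₂ t‖ ^ 2 + M * ‖φ₁ t - φ₂ t‖ ^ 2) +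
        (∫ x, ‖(d₁.f - d₂.f) (t, x)‖ ^ 2 ∂volume.restrict Ω +
          (9 * P.k ^ 2 + M * P.gamma) * ‖d₁.etaStar - d₂.etaStar‖ ^ 2) := by
  have hl := (h₁.eta_L2W.2.and h₂.eta_L2W.2).and (h₁.phi_L2W.2.and h₂.phi_L2W.2)
  have he := ((h₁.ae_equations hαℓ).and (h₂.ae_equations hαℓ)).and (h₁.zeta_mem.and h₂.zeta_mem)
  have hf := (ae_exists_slice (d₁.f - d₂.f)).and (ae_ae_sub d₁.f d₂.f)
  refine (hl.and (he.and hf)).mono fun t ht => ?_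
  obtain ⟨⟨⟨lη₁, lη₂⟩, lφ₁, lφ₂⟩, ⟨⟨⟨F₁, X₁, R₁, hF₁, hX₁, hR₁, eη₁, eφ₁⟩,
    F₂, X₂, R₂, hF₂, hX₂, hR₂, eη₂, eφ₂⟩, hζ₁, hζ₂⟩, ⟨F, hF, hFn⟩, hf⟩ := ht
  rw [← hFn, eq_sub_of_ae_eq_slice hF hf hF₁ hF₂]
  exact W.energy_inequality_sub hP.k hP.gamma hM L.coe_nonneg hMν hP.alpha lη₁ lη₂ lφ₁ lφ₂
    (eta_equation_sub eη₁ eη₂) (phi_equation_sub eφ₁ eφ₂) (hA.monotone _ _ _ hζ₁ _ hζ₂)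
    (hβ.inner_sub_nonneg hX₁ hX₂) (norm_sub_le_of_ae_eq_comp hπ hR₁ hR₂)

/-! ### Continuous dependence -/

/-- The distance of two sets of data on the right-hand side of the continuous dependence
estimate. -/
noncomputable def dataDist (d₁ d₂ : Data Ω T) : ℝ :=
  ‖d₁.f - d₂.f‖ + ‖d₁.etaStar - d₂.etaStar‖
    + ‖H1.toL2 d₁.eta0 - H1.toL2 d₂.eta0‖ + ‖H1.toL2 d₁.phi0 - H1.toL2 d₂.phi0‖

theorem dataDist_self (d : Data Ω T) : dataDist d d = 0 := by
  simp [dataDist]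

theorem dataDist_nonneg (d₁ d₂ : Data Ω T) : 0 ≤ dataDist d₁ d₂ := by
  unfold dataDist
  positivity

/-- Collects the initial energy (c, d) and the integrated sources (a, b) into the square of the
single quantity `dataDist`. -/
theorem weighted_sq_le {a b c d M N : ℝ} (ha : 0 ≤ a) (hb : 0 ≤ b) (hc : 0 ≤ c) (hd : 0 ≤ d)
    (hM : 0 ≤ M) (hN : 0 ≤ N) :
    c ^ 2 + M * d ^ 2 + (a ^ 2 + N * b ^ 2) ≤ (2 + M + N) * (a + b + c + d) ^ 2 := by
  have h1 : a ^ 2 ≤ (a + b + c + d) ^ 2 := pow_le_pow_left₀ ha (by linarith) 2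
  have h2 : b ^ 2 ≤ (a + b + c + d) ^ 2 := pow_le_pow_left₀ hb (by linarith) 2
  have h3 : c ^ 2 ≤ (a + b + c + d) ^ 2 := pow_le_pow_left₀ hc (by linarith) 2
  have h4 : d ^ 2 ≤ (a + b + c + d) ^ 2 := pow_le_pow_left₀ hd (by linarith) 2
  linarith [mul_le_mul_of_nonneg_left h4 hM, mul_le_mul_of_nonneg_left h2 hN]

theorem le_inv_mul_of_mul_le {m y R B : ℝ} (hm : 0 < m) (hB : 0 ≤ B) (hR : m⁻¹ ≤ R)
    (h : m * y ≤ B) : y ≤ R * B := by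
  have h1 : y ≤ m⁻¹ * B := by
    rw [inv_mul_eq_div, le_div_iff₀ hm]
    linarith
  exact h1.trans (mul_le_mul_of_nonneg_right hR hB)

theorem isLift_sub {u₁ u₂ : ℝ → L2 Ω} {w₁ w₂ : ℝ → W Ω} (h₁ : IsLift T W.toL2 u₁ w₁)
    (h₂ : IsLift T W.toL2 u₂ w₂) :
    IsLift T H1.toL2 (u₁ - u₂) (fun t => W.toH1 (w₁ t - w₂ t)) := by
  refine (Filter.Eventually.and h₁ h₂).mono fun t ht => ?_
  exact (map_sub W.toL2 _ _).trans (congrArg₂ _ ht.1 ht.2)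

theorem memLp_toH1_sub {w₁ w₂ : ℝ → W Ω} (h₁ : MemLp w₁ 2 (timeMeasure T))
    (h₂ : MemLp w₂ 2 (timeMeasure T)) :
    MemLp (fun t => W.toH1 (w₁ t - w₂ t)) 2 (timeMeasure T) :=
  W.toH1.comp_memLp' (h₁.sub h₂)

/-- The energy estimate for the difference of two solutions, with explicit constants. -/
theorem SolvesWith.energy_estimate_sub (hT : 0 ≤ T) {P : Parameters} (hP : P.Positive)
    (hαℓ : P.alpha = P.ell) {βhat : ℝ → ℝ≥0∞} {πhat : ℝ → ℝ} {A : L2 Ω → Set (L2 Ω)} {L : ℝ≥0}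
    (hβ : IsConvexPotential βhat) (hπ : LipschitzWith L (deriv πhat))
    (hA : IsMaximalMonotone A) {d₁ d₂ : Data Ω T}
    {η₁ φ₁ η₁' φ₁' η₂ φ₂ η₂' φ₂' : ℝ → L2 Ω} {ηW₁ φW₁ ηW₂ φW₂ : ℝ → W Ω} {ζ₁ ζ₂ : ℝ → L2 Ω}
    {ξ₁ ξ₂ : L2Q Ω T}
    (h₁ : SolvesWith P βhat πhat A d₁ η₁ φ₁ η₁' φ₁' ηW₁ φW₁ ζ₁ ξ₁)
    (h₂ : SolvesWith P βhat πhat A d₂ η₂ φ₂ η₂' φ₂' ηW₂ φW₂ ζ₂ ξ₂) {M c N B : ℝ} (hM : 0 < M)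
    (hMν : M * P.nu = P.k * P.alpha ^ 2) (hc : c = 2 + M * P.gamma + 2 * L + 2 * P.gamma)
    (hN : N = 9 * P.k ^ 2 + M * P.gamma) (hB : B = (2 + M + T * N) * dataDist d₁ d₂ ^ 2) :
    (∀ t ∈ Icc 0 T, ‖(η₁ - η₂) t‖ ^ 2 + M * ‖(φ₁ - φ₂) t‖ ^ 2 ≤ B * Real.exp (c * T)) ∧
    P.k * ∫ t, (W.toH1 (ηW₁ t - ηW₂ t)).dirichlet ∂timeMeasure T +
      P.k * P.alpha ^ 2 * ∫ t, (W.toH1 (φW₁ t - φW₂ t)).dirichlet ∂timeMeasure T ≤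
        B * (1 + c * T * Real.exp (c * T)) := by
  have hk := hP.k
  have hγ := hP.gamma
  have hα := hP.alpha
  have hc0 : 0 < c := by
    rw [hc]
    positivity
  have hN0 : 0 ≤ N := by
    rw [hN]
    positivity
  have hi := (integrable_slice_norm_sq (d₁.f - d₂.f)).add
    (integrable_const (N * ‖d₁.etaStar - d₂.etaStar‖ ^ 2))
  have key := energy_estimate hT hM.le hk.le (b := P.k * P.alpha ^ 2) (by positivity) hc0
    (g := fun t => ∫ x, ‖(d₁.f - d₂.f) (t, x)‖ ^ 2 ∂volume.restrict Ω +
      N * ‖d₁.etaStar - d₂.etaStar‖ ^ 2)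
    (h₁.eta_H1H.sub h₂.eta_H1H) (h₁.phi_H1H.sub h₂.phi_H1H)
    (memLp_toH1_sub h₁.eta_L2W.1 h₂.eta_L2W.1) (memLp_toH1_sub h₁.phi_L2W.1 h₂.phi_L2W.1)
    (isLift_sub h₁.eta_L2W.2 h₂.eta_L2W.2) (isLift_sub h₁.phi_L2W.2 h₂.phi_L2W.2) hi
    (fun t => add_nonneg (integral_nonneg fun x => sq_nonneg _) (by positivity)) (by
      rw [hc, hN]
      exact h₁.ae_energy_inequality hP hαℓ hβ hπ hA h₂ hM hMν)
  have hg : ∫ t, (∫ x, ‖(d₁.f - d₂.f) (t, x)‖ ^ 2 ∂volume.restrict Ω +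
      N * ‖d₁.etaStar - d₂.etaStar‖ ^ 2) ∂timeMeasure T =
      ‖d₁.f - d₂.f‖ ^ 2 + T * N * ‖d₁.etaStar - d₂.etaStar‖ ^ 2 := by
    rw [integral_add (integrable_slice_norm_sq _) (integrable_const _), integral_norm_sq,
      integral_const]
    simp [hT, mul_assoc]
  have hS : ‖(η₁ - η₂) 0‖ ^ 2 + M * ‖(φ₁ - φ₂) 0‖ ^ 2 +
      (‖d₁.f - d₂.f‖ ^ 2 + T * N * ‖d₁.etaStar - d₂.etaStar‖ ^ 2) ≤ B := by
    rw [hB, Pi.sub_apply, Pi.sub_apply, h₁.eta_init, h₂.eta_init, h₁.phi_init, h₂.phi_init]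
    exact weighted_sq_le (norm_nonneg _) (norm_nonneg _) (norm_nonneg _) (norm_nonneg _) hM.le
      (by positivity)
  rw [hg] at key
  exact ⟨fun t ht => (key.1 t ht).trans (by gcongr), key.2.trans (by gcongr)⟩

/-- The difference of two solutions is bounded by the distance of the data. -/
theorem exists_bound_of_isSolution (hT : 0 ≤ T) {P : Parameters} (hP : P.Positive)
    (hαℓ : P.alpha = P.ell) (L : ℝ≥0) :
    ∃ K : ℝ, 0 < K ∧ ∀ (βhat : ℝ → ℝ≥0∞) (πhat : ℝ → ℝ) (A : L2 Ω → Set (L2 Ω)),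
      IsConvexPotential βhat → LipschitzWith L (deriv πhat) → IsMaximalMonotone A →
      ∀ (d₁ d₂ : Data Ω T) (η₁ φ₁ η₂ φ₂ : ℝ → L2 Ω),
        IsSolution P βhat πhat A d₁ η₁ φ₁ → IsSolution P βhat πhat A d₂ η₂ φ₂ →
        ∀ u ∈ ({η₁ - η₂, φ₁ - φ₂} : Set (ℝ → L2 Ω)),
          (∀ t ∈ Icc 0 T, ‖u t‖ ^ 2 ≤ K * dataDist d₁ d₂ ^ 2) ∧
          ∃ v : ℝ → H1 Ω, MemLp v 2 (timeMeasure T) ∧ IsLift T H1.toL2 u v ∧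
            ∫ t, (v t).dirichlet ∂timeMeasure T ≤ K * dataDist d₁ d₂ ^ 2 := by
  have hk := hP.k
  have hγ := hP.gamma
  have hα := hP.alpha
  have hν := hP.nu
  -- This weight makes the dissipation of the second equation twice the gradient term in p that
  -- Young's inequality produces in the first.
  obtain ⟨M, hM, hMν⟩ : ∃ M : ℝ, 0 < M ∧ M * P.nu = P.k * P.alpha ^ 2 :=
    ⟨P.k * P.alpha ^ 2 / P.nu, by positivity, div_mul_cancel₀ _ hν.ne'⟩
  obtain ⟨c, hc⟩ : ∃ c, c = 2 + M * P.gamma + 2 * L + 2 * P.gamma := ⟨_, rfl⟩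
  obtain ⟨N, hN⟩ : ∃ N, N = 9 * P.k ^ 2 + M * P.gamma := ⟨_, rfl⟩
  have hc0 : 0 < c := by
    rw [hc]
    positivity
  have hN0 : 0 ≤ N := by
    rw [hN]
    positivity
  have hkα : 0 < P.k * P.alpha ^ 2 := by positivity
  -- The first factor dominates the inverse of each of the weights 1, M, k and kα² of the four
  -- quantities to be isolated; the last one adds the Grönwall factors for the energy and for the
  -- dissipation.
  refine ⟨(1 + M⁻¹ + P.k⁻¹ + (P.k * P.alpha ^ 2)⁻¹) * ((2 + M + T * N) *
    (Real.exp (c * T) + (1 + c * T * Real.exp (c * T)))), by positivity, ?_⟩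
  rintro βhat πhat A hβ hπ hA d₁ d₂ η₁ φ₁ η₂ φ₂ ⟨η₁', φ₁', ηW₁, φW₁, ζ₁, ξ₁, h₁⟩
    ⟨η₂', φ₂', ηW₂, φW₂, ζ₂, ξ₂, h₂⟩
  obtain ⟨hE, hD⟩ := h₁.energy_estimate_sub hT hP hαℓ hβ hπ hA h₂ hM hMν hc hN rfl
  have hB0 : 0 ≤ (2 + M + T * N) * dataDist d₁ d₂ ^ 2 := by positivity
  have hx := Real.exp_pos (c * T)
  have hy : 0 ≤ c * T * Real.exp (c * T) := by positivity
  have hR1 := inv_pos.2 hM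
  have hR2 := inv_pos.2 hk
  have hR3 := inv_pos.2 hkα
  have hB1 := mul_nonneg hB0 hx.le
  have hB2 := mul_nonneg hB0 (add_nonneg zero_le_one hy)
  have hB := add_nonneg hB1 hB2
  have hI : ∀ w : ℝ → W Ω, 0 ≤ ∫ t, (W.toH1 (w t)).dirichlet ∂timeMeasure T := fun w =>
    integral_nonneg fun t => H1.dirichlet_nonneg _
  have hI₁ := mul_nonneg hk.le (hI fun t => ηW₁ t - ηW₂ t)
  have hI₂ := mul_nonneg hkα.le (hI fun t => φW₁ t - φW₂ t)
  have hfin : ∀ {m y : ℝ}, 0 < m → m⁻¹ ≤ 1 + M⁻¹ + P.k⁻¹ + (P.k * P.alpha ^ 2)⁻¹ →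
      m * y ≤ (2 + M + T * N) * dataDist d₁ d₂ ^ 2 * Real.exp (c * T) +
        (2 + M + T * N) * dataDist d₁ d₂ ^ 2 * (1 + c * T * Real.exp (c * T)) →
      y ≤ (1 + M⁻¹ + P.k⁻¹ + (P.k * P.alpha ^ 2)⁻¹) * ((2 + M + T * N) *
        (Real.exp (c * T) + (1 + c * T * Real.exp (c * T)))) * dataDist d₁ d₂ ^ 2 := by
    intro m y hm hR h
    refine (le_inv_mul_of_mul_le hm hB hR h).trans_eq ?_
    ring
  rintro u (rfl | rfl)
  · refine ⟨fun t ht => hfin one_pos (by rw [inv_one]; linarith) ?_, _,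
      memLp_toH1_sub h₁.eta_L2W.1 h₂.eta_L2W.1, isLift_sub h₁.eta_L2W.2 h₂.eta_L2W.2,
      hfin hk (by linarith) (by linarith)⟩
    have := mul_nonneg hM.le (sq_nonneg ‖(φ₁ - φ₂) t‖)
    linarith [hE t ht]
  · refine ⟨fun t ht => hfin hM (by linarith) ?_, _,
      memLp_toH1_sub h₁.phi_L2W.1 h₂.phi_L2W.1, isLift_sub h₁.phi_L2W.2 h₂.phi_L2W.2,
      hfin hkα (by linarith) (by linarith)⟩
    linarith [hE t ht, sq_nonneg ‖(η₁ - η₂) t‖]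

end PhaseField

open PhaseField
theorem theorem2p2 (Ω : Set E3) (hΩ : IsBoundedC1Domain Ω) (T : ℝ) (hT : 0 < T)
    (P : Parameters) (hP : P.Positive) (hαℓ : P.alpha = P.ell) :
    -- uniqueness
    (∀ (βhat : ℝ → ℝ≥0∞) (πhat : ℝ → ℝ) (A : L2 Ω → Set (L2 Ω)),
      IsConvexPotential βhat → ContDiff ℝ 1 πhat → (∃ L : ℝ≥0, LipschitzWith L (deriv πhat)) →
      IsAdmissibleOperator A →
      ∀ (d : Data Ω T) (η₁ φ₁ η₂ φ₂ : ℝ → L2 Ω),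
        IsSolution P βhat πhat A d η₁ φ₁ → IsSolution P βhat πhat A d η₂ φ₂ →
        ∀ t ∈ Icc 0 T, η₁ t = η₂ t ∧ φ₁ t = φ₂ t) ∧
    -- continuous dependence
    (∀ L : ℝ≥0, ∃ C : ℝ, 0 < C ∧
      ∀ (βhat : ℝ → ℝ≥0∞) (πhat : ℝ → ℝ) (A : L2 Ω → Set (L2 Ω)),
      IsConvexPotential βhat → ContDiff ℝ 1 πhat → LipschitzWith L (deriv πhat) →
      IsAdmissibleOperator A →
      ∀ (d₁ d₂ : Data Ω T) (η₁ φ₁ η₂ φ₂ : ℝ → L2 Ω),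
        IsSolution P βhat πhat A d₁ η₁ φ₁ → IsSolution P βhat πhat A d₂ η₂ φ₂ →
        energyNorm T (η₁ - η₂) + energyNorm T (φ₁ - φ₂) ≤
          ENNReal.ofReal (C * (‖d₁.f - d₂.f‖ + ‖d₁.etaStar - d₂.etaStar‖
            + ‖H1.toL2 d₁.eta0 - H1.toL2 d₂.eta0‖ + ‖H1.toL2 d₁.phi0 - H1.toL2 d₂.phi0‖))) := by
  refine ⟨?_, fun L => ?_⟩
  · rintro βhat πhat A hβ - ⟨L, hπ⟩ hA d η₁ φ₁ η₂ φ₂ h₁ h₂ t ht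
    obtain ⟨K, -, hK⟩ := exists_bound_of_isSolution (Ω := Ω) hT.le hP hαℓ L
    have hu := hK βhat πhat A hβ hπ hA.maximalMonotone d d η₁ φ₁ η₂ φ₂ h₁ h₂
    rw [dataDist_self] at hu
    -- The bound holds at every t in [0, T], not merely almost everywhere, and so does the equality.
    have hzero : ∀ {x y : L2 Ω}, ‖x - y‖ ^ 2 ≤ K * 0 ^ 2 → x = y := by
      intro x y h
      have h0 : ‖x - y‖ ^ 2 = 0 := le_antisymm (by simpa using h) (sq_nonneg _)
      exact sub_eq_zero.1 (norm_eq_zero.1 (pow_eq_zero_iff two_ne_zero |>.1 h0))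
    exact ⟨hzero ((hu _ (.inl rfl)).1 t ht), hzero ((hu _ (.inr rfl)).1 t ht)⟩
  · obtain ⟨K, hK0, hK⟩ := exists_bound_of_isSolution (Ω := Ω) hT.le hP hαℓ L
    -- `energyNorm_le` with B = G = K · `dataDist`² gives the bracket times `dataDist`; the 2 counts
    -- η and φ. K is fixed before the nonlinearities and the data, so C depends on none of them
    -- beyond L.
    refine ⟨2 * (√K + √(T * K + K)), by positivity, ?_⟩
    intro βhat πhat A hβ _ hπ hA d₁ d₂ η₁ φ₁ η₂ φ₂ h₁ h₂
    have hX := dataDist_nonneg d₁ d₂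
    have hu : ∀ u ∈ ({η₁ - η₂, φ₁ - φ₂} : Set (ℝ → L2 Ω)),
        energyNorm T u ≤ ENNReal.ofReal ((√K + √(T * K + K)) * dataDist d₁ d₂) := by
      intro u hu
      obtain ⟨hb, v, hv, hl, hG⟩ :=
        hK βhat πhat A hβ hπ hA.maximalMonotone d₁ d₂ η₁ φ₁ η₂ φ₂ h₁ h₂ u hu
      refine (energyNorm_le hT.le hv hl hb hG).trans_eq (congrArg ENNReal.ofReal ?_)
      rw [← mul_assoc, ← add_mul, Real.sqrt_mul hK0.le, Real.sqrt_mul (by positivity),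
        Real.sqrt_sq hX, add_mul]
    refine (add_le_add (hu _ (.inl rfl)) (hu _ (.inr rfl))).trans_eq ?_
    rw [← ENNReal.ofReal_add (by positivity) (by positivity)]
    refine congrArg ENNReal.ofReal ?_
    change _ = 2 * (√K + √(T * K + K)) * dataDist d₁ d₂
    ring
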